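/- Let $G$ be an infinite connected (simple, undirected) graph of bounded degree, i.e. there is an integer $E$ such that every vertex has at most $E$ neighbours. Let $k$ be a nonnegative integer, and let $G_k$, the $k$-fuzz of $G$, be the graph obtained from $G$ by adding an edge between any two distinct vertices $x,y$ such that one can go from $x$ to $y$ in at most $k$ steps along edges of $G$. For a graph $H$ and a vertex $o$, simple random walk on $H$ started at $o$ is the Markov chain that starts at $o$ and at each step moves to a uniformly chosen neighbour of its current position; it is called recurrent if the probability $p_{\mathrm{esc}}$ that it never returns to $o$ is $0$, and transient if $p_{\mathrm{esc}}>0$. Then simple random walk on $G$ and simple random walk on $G_k$ have the same type: for any choice of reference points $o$ for $G$ and $o'$ for $G_k$, either both walks are recurrent or both walks are transient. -/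

import Mathlib

open MeasureTheory ProbabilityTheory

/-- The `k`-fuzz of `G`: the graph obtained from `G` by adding an edge between any two distinct
vertices `x`, `y` such that one can go from `x` to `y` in at most `k` steps along edges of `G`. -/
def SimpleGraph.kFuzz {V : Type*} (G : SimpleGraph V) (k : ℕ) : SimpleGraph V where
  Adj x y := x ≠ y ∧ (G.Adj x y ∨ ∃ p : G.Walk x y, p.length ≤ k)
  symm := ⟨by
    rintro x y ⟨hne, h | ⟨p, hp⟩⟩
    · exact ⟨hne.symm, Or.inl h.symm⟩
    · exact ⟨hne.symm, Or.inr ⟨p.reverse, by simpa using hp⟩⟩⟩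
  loopless := ⟨fun _ h => h.1 rfl⟩

/-- A graph is of bounded degree if some integer `E` bounds the number of edges from any vertex. -/
def SimpleGraph.BoundedDegree {V : Type*} (G : SimpleGraph V) : Prop :=
  ∃ E : ℕ, ∀ x : V, (G.neighborSet x).encard ≤ E

open Classical in
/-- One step of simple random walk on `G` from `x`: a uniformly chosen neighbour of `x`.
(At a vertex whose neighbour set is empty or infinite, the walk stays put; this never happens
in an infinite connected graph of bounded degree, nor in its `k`-fuzz.) -/
noncomputable def SimpleGraph.srwStep {V : Type*} (G : SimpleGraph V) (x : V) : PMF V :=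
  if h : (G.neighborSet x).Finite ∧ (G.neighborSet x).Nonempty then
    PMF.uniformOfFinset h.1.toFinset (h.1.toFinset_nonempty.2 h.2)
  else PMF.pure x

/-- The transition kernel of simple random walk, as a function of the history `x₀, …, xₙ`:
the law of the next position depends only on the current position `xₙ`. -/
noncomputable def SimpleGraph.srwKernel {V : Type*} [MeasurableSpace V]
    [DiscreteMeasurableSpace V] (G : SimpleGraph V) (n : ℕ) :
    Kernel (Π _ : Finset.Iic n, V) V where
  toFun h := (G.srwStep (h ⟨n, Finset.mem_Iic.2 le_rfl⟩)).toMeasure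
  measurable' :=
    (Measurable.of_discrete (f := fun x : V => (G.srwStep x).toMeasure)).comp
      (measurable_pi_apply _)

instance SimpleGraph.srwKernel_isMarkovKernel {V : Type*} [MeasurableSpace V]
    [DiscreteMeasurableSpace V] (G : SimpleGraph V) (n : ℕ) :
    IsMarkovKernel (G.srwKernel n) :=
  ⟨fun h => PMF.toMeasure.isProbabilityMeasure
    (G.srwStep (h ⟨n, Finset.mem_Iic.2 le_rfl⟩))⟩

/-- The law, on trajectories `ω : ℕ → V`, of simple random walk on `G` started at `o`. -/
noncomputable def SimpleGraph.srwLaw {V : Type*} [MeasurableSpace V]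
    [DiscreteMeasurableSpace V] (G : SimpleGraph V) (o : V) : Measure (ℕ → V) :=
  Kernel.traj (X := fun _ => V) G.srwKernel 0 (fun _ => o)

/-- The escape probability: the probability that simple random walk on `G` started at `o`
never returns to `o`. The vertex set carries the discrete σ-algebra. -/
noncomputable def SimpleGraph.escapeProb {V : Type*} (G : SimpleGraph V) (o : V) : ENNReal :=
  letI : MeasurableSpace V := ⊤
  G.srwLaw o {ω | ∀ n : ℕ, 1 ≤ n → ω n ≠ o}

/-- Simple random walk on `G`, with reference point `o`, is recurrent. -/
def SimpleGraph.SrwRecurrent {V : Type*} (G : SimpleGraph V) (o : V) : Prop :=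
  G.escapeProb o = 0

/-- Simple random walk on `G`, with reference point `o`, is transient. -/
def SimpleGraph.SrwTransient {V : Type*} (G : SimpleGraph V) (o : V) : Prop :=
  0 < G.escapeProb o

/-!
The two walks are compared through capacity. The Dirichlet energy of a function `f` on the vertices
is the sum of `(f x - f y) ^ 2` over adjacent pairs, and a vertex `o` has positive capacity when
`f o ^ 2` is at most a constant times the energy of `f`, for all finitely supported `f`.

Simple random walk is transient from `o` exactly when `o` has positive capacity
(`srwTransient_iff_posCapacity`). Let `hₙ x` be the probability of being at `o` at some time at most
`n` when starting at `x`; it is finitely supported, equals `1` at `o`, and satisfies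
`hₙ₊₁ x = (P hₙ) x` for `x ≠ o`, where `P` averages over neighbours. By the Markov property,
`1 - (P hₙ) o` is the probability of avoiding `o` at the times `1, …, n + 1`, so it tends to the
escape probability `p` (`tendsto_escapeProb`). Since `hₙ` increases with `n`, it is subharmonic off
`o`, and summation by parts bounds its energy by a multiple of `1 - (P hₙ) o`. If `p = 0`, the
functions `hₙ` therefore show that the capacity vanishes. If `p > 0`, the energy form of a finitely
supported `f` with `hₙ` tends to a multiple of `p * f o`, and the Cauchy-Schwarz inequality gives
the bound on `f o ^ 2`. Only finite sums occur: no limit of the energies of `hₙ` is needed.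

Positivity of the capacity is insensitive to passing to the fuzz (`posCapacity_kFuzz_iff`). The
energy on `G` is at most that on the fuzz. Conversely, let `Qₙ` be the sum of `(f x - f y) ^ 2` over
the endpoints of all walks of length `n` that may stay put; splitting off the last step gives
`Qₙ₊₁ ≤ 2 (E + 1) Qₙ + 2 (E + 1) ^ n * energy`, where `E` bounds the degrees, so `Qₙ` is controlled
by the energy on `G` (`exists_lazyEnergy_le`), and for `n = k + 1` it dominates the energy on the
`k`-fuzz. The same bound controls `(f o - f o') ^ 2`, whence the independence of the reference
point.
-/

open Filter
open scoped ENNReal Topology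

namespace SimpleGraph

/-! ### Dirichlet energy -/

open Classical in
/-- The Dirichlet energy of `f` on `G`, with values in `[0, ∞]`: the sum of `(f x - f y) ^ 2` over
all ordered pairs of adjacent vertices, so that every edge counts twice. -/
noncomputable def dirichletEnergy {V : Type*} (G : SimpleGraph V) (f : V → ℝ) : ℝ≥0∞ :=
  ∑' x, ∑' y, if G.Adj x y then ENNReal.ofReal ((f x - f y) ^ 2) else 0

/-- The vertex `o` has positive capacity in `G`: the value at `o` of a finitely supported function
is controlled by its Dirichlet energy. -/
def PosCapacity {V : Type*} (G : SimpleGraph V) (o : V) : Prop :=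
  ∃ C : ℝ≥0∞, C ≠ ∞ ∧ ∀ f : V → ℝ, f.support.Finite →
    ENNReal.ofReal (f o ^ 2) ≤ C * G.dirichletEnergy f

/-! ### Comparison of energies -/

section Comparison

variable {V : Type*} {G H : SimpleGraph V}

lemma ofReal_sub_sq_le (a b c : ℝ) :
    ENNReal.ofReal ((a - c) ^ 2) ≤
      2 * ENNReal.ofReal ((a - b) ^ 2) + 2 * ENNReal.ofReal ((b - c) ^ 2) := by
  have h2 : (2 : ℝ≥0∞) = ENNReal.ofReal 2 := by simp
  rw [h2, ← ENNReal.ofReal_mul (by norm_num), ← ENNReal.ofReal_mul (by norm_num),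
    ← ENNReal.ofReal_add (by positivity) (by positivity)]
  apply ENNReal.ofReal_le_ofReal
  nlinarith [sq_nonneg (a - b - (b - c))]

lemma dirichletEnergy_mono (h : G ≤ H) (f : V → ℝ) :
    G.dirichletEnergy f ≤ H.dirichletEnergy f := by
  refine ENNReal.tsum_le_tsum fun x => ENNReal.tsum_le_tsum fun y => ?_
  by_cases hxy : G.Adj x y
  · simp [hxy, h hxy]
  · simp [hxy]

open Classical in
/-- The number of lazy walks of length `n` from `x` to `y`, that is, of walks that may stay put at
any step. -/
noncomputable def lazyWalks (G : SimpleGraph V) : ℕ → V → V → ℝ≥0∞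
  | 0 => fun x y => if x = y then 1 else 0
  | n + 1 => fun x y => ∑' z, G.lazyWalks n x z * if z = y ∨ G.Adj z y then 1 else 0

/-- The sum of `(f x - f y) ^ 2` over all lazy walks of length `n`, with `x` and `y` the endpoints
of the walk. -/
noncomputable def lazyEnergy (G : SimpleGraph V) (n : ℕ) (f : V → ℝ) : ℝ≥0∞ :=
  ∑' x, ∑' y, G.lazyWalks n x y * ENNReal.ofReal ((f x - f y) ^ 2)

open Classical in
lemma one_le_lazyWalks_of_walk {x y : V} (n : ℕ) (p : G.Walk x y) (hp : p.length ≤ n) :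
    1 ≤ G.lazyWalks n x y := by
  induction n generalizing y with
  | zero =>
    obtain rfl := Walk.eq_of_length_eq_zero (Nat.le_zero.1 hp)
    simp [lazyWalks]
  | succ n ih =>
    have key : ∃ z, (z = y ∨ G.Adj z y) ∧ ∃ q : G.Walk x z, q.length ≤ n := by
      induction p using Walk.concatRec with
      | Hnil => exact ⟨_, Or.inl rfl, Walk.nil, by simp⟩
      | Hconcat q h => exact ⟨_, Or.inr h, q, by simpa using hp⟩
    obtain ⟨z, hz, q, hq⟩ := key
    calc (1 : ℝ≥0∞) ≤ G.lazyWalks n x z * if z = y ∨ G.Adj z y then 1 else 0 := by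
          simpa [hz] using ih q hq
      _ ≤ _ := ENNReal.le_tsum (f := fun z =>
          G.lazyWalks n x z * if z = y ∨ G.Adj z y then 1 else 0) z

open Classical in
lemma tsum_lazyStep_le {E : ℕ} (hE : ∀ x, (G.neighborSet x).encard ≤ E) (x : V) :
    ∑' y, (if x = y ∨ G.Adj x y then (1 : ℝ≥0∞) else 0) ≤ E + 1 := by
  have h1 : ∑' y, (if G.Adj x y then (1 : ℝ≥0∞) else 0) ≤ E := by
    have : ∑' y, (if G.Adj x y then (1 : ℝ≥0∞) else 0)
        = ∑' y, (G.neighborSet x).indicator (fun _ => (1 : ℝ≥0∞)) y := by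
      congr 1
    rw [this, ← tsum_subtype (G.neighborSet x) (fun _ => (1 : ℝ≥0∞)), ENNReal.tsum_set_one]
    exact_mod_cast hE x
  calc ∑' y, (if x = y ∨ G.Adj x y then (1 : ℝ≥0∞) else 0)
      ≤ ∑' y, ((if G.Adj x y then (1 : ℝ≥0∞) else 0) + if y = x then 1 else 0) := by
        refine ENNReal.tsum_le_tsum fun y => ?_
        by_cases h1 : G.Adj x y <;> by_cases h2 : y = x <;> simp [h1, h2, eq_comm (a := x)]
    _ = ∑' y, (if G.Adj x y then (1 : ℝ≥0∞) else 0) + 1 := by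
        rw [ENNReal.tsum_add, tsum_ite_eq]
    _ ≤ _ := by gcongr

/-- In a graph of bounded degree, the number of lazy walks of given length that end at a given
vertex is bounded. -/
lemma tsum_lazyWalks_le {E : ℕ} (hE : ∀ x, (G.neighborSet x).encard ≤ E) (n : ℕ) (y : V) :
    ∑' x, G.lazyWalks n x y ≤ (E + 1) ^ n := by
  classical
  induction n generalizing y with
  | zero => simp [lazyWalks]
  | succ n ih =>
    simp only [lazyWalks]
    rw [ENNReal.tsum_comm]
    simp_rw [ENNReal.tsum_mul_right]
    calc ∑' z, (∑' x, G.lazyWalks n x z) * (if z = y ∨ G.Adj z y then (1 : ℝ≥0∞) else 0)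
        ≤ ∑' z, (E + 1) ^ n * (if y = z ∨ G.Adj y z then (1 : ℝ≥0∞) else 0) := by
          refine ENNReal.tsum_le_tsum fun z => ?_
          rw [eq_comm, G.adj_comm]
          gcongr
          exact ih z
      _ ≤ _ := by
          rw [ENNReal.tsum_mul_left, pow_succ]
          gcongr
          exact tsum_lazyStep_le hE y

lemma lazyEnergy_succ_le {E : ℕ} (hE : ∀ x, (G.neighborSet x).encard ≤ E) (n : ℕ) (f : V → ℝ) :
    G.lazyEnergy (n + 1) f ≤
      2 * (E + 1) * G.lazyEnergy n f + 2 * (E + 1) ^ n * G.dirichletEnergy f := by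
  classical
  set q : V → V → ℝ≥0∞ := fun x y => ENNReal.ofReal ((f x - f y) ^ 2) with hq
  set a : V → V → ℝ≥0∞ := fun x y => if x = y ∨ G.Adj x y then 1 else 0 with ha
  have hq3 : ∀ x y z, q x y ≤ 2 * q x z + 2 * q z y := fun x y z => ofReal_sub_sq_le _ _ _
  have haq : ∑' z, ∑' y, a z y * q z y = G.dirichletEnergy f := by
    refine tsum_congr fun z => tsum_congr fun y => ?_
    by_cases h1 : G.Adj z y <;> by_cases h2 : z = y <;> simp [ha, hq, h1, h2]
  calc G.lazyEnergy (n + 1) f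
      = ∑' x, ∑' y, ∑' z, G.lazyWalks n x z * a z y * q x y := by
        simp only [lazyEnergy, lazyWalks, ENNReal.tsum_mul_right, ha, hq]
    _ ≤ ∑' x, ∑' y, ∑' z, (2 * (G.lazyWalks n x z * q x z) * a z y
          + 2 * (G.lazyWalks n x z * (a z y * q z y))) := by
        refine ENNReal.tsum_le_tsum fun x => ENNReal.tsum_le_tsum fun y =>
          ENNReal.tsum_le_tsum fun z => ?_
        calc G.lazyWalks n x z * a z y * q x y
            ≤ G.lazyWalks n x z * a z y * (2 * q x z + 2 * q z y) := by gcongr; exact hq3 x y z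
          _ = _ := by ring
    _ = (∑' x, ∑' z, 2 * (G.lazyWalks n x z * q x z) * ∑' y, a z y)
          + 2 * ∑' z, (∑' x, G.lazyWalks n x z) * ∑' y, a z y * q z y := by
        simp_rw [ENNReal.tsum_add]
        congr 1
        · refine tsum_congr fun x => ?_
          rw [ENNReal.tsum_comm]
          simp_rw [ENNReal.tsum_mul_left]
        · simp_rw [ENNReal.tsum_mul_left]
          congr 1
          have : ∀ x, ∑' y, ∑' z, G.lazyWalks n x z * (a z y * q z y)
              = ∑' z, G.lazyWalks n x z * ∑' y, a z y * q z y := by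
            intro x
            rw [ENNReal.tsum_comm]
            simp_rw [ENNReal.tsum_mul_left]
          simp_rw [this]
          rw [ENNReal.tsum_comm]
          simp_rw [ENNReal.tsum_mul_right]
    _ ≤ (∑' x, ∑' z, 2 * (G.lazyWalks n x z * q x z) * (E + 1))
          + 2 * ∑' z, (E + 1) ^ n * ∑' y, a z y * q z y := by
        gcongr with x z z
        · exact tsum_lazyStep_le hE z
        · exact tsum_lazyWalks_le hE n z
    _ = _ := by
        simp_rw [ENNReal.tsum_mul_right, ENNReal.tsum_mul_left, haq, lazyEnergy, hq]
        ring

/-- In a graph of bounded degree, differences along lazy walks of a fixed length are controlled by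
the Dirichlet energy. -/
lemma exists_lazyEnergy_le (hG : G.BoundedDegree) (n : ℕ) :
    ∃ C : ℝ≥0∞, C ≠ ∞ ∧ ∀ f, G.lazyEnergy n f ≤ C * G.dirichletEnergy f := by
  classical
  obtain ⟨E, hE⟩ := hG
  induction n with
  | zero =>
    refine ⟨0, by simp, fun f => ?_⟩
    simp only [zero_mul, nonpos_iff_eq_zero, lazyEnergy, lazyWalks]
    refine ENNReal.tsum_eq_zero.2 fun x => ENNReal.tsum_eq_zero.2 fun y => ?_
    by_cases h : x = y <;> simp [h]
  | succ n ih =>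
    obtain ⟨C, hC, h⟩ := ih
    refine ⟨2 * (E + 1) * C + 2 * (E + 1) ^ n, ?_, fun f => ?_⟩
    · finiteness
    · refine (lazyEnergy_succ_le hE n f).trans ?_
      rw [add_mul, mul_assoc _ C]
      gcongr
      exact h f

/-- The square of the difference of values at two fixed vertices is controlled by the Dirichlet
energy. -/
lemma exists_ofReal_sub_sq_le (hconn : G.Connected) (hG : G.BoundedDegree) (x y : V) :
    ∃ C : ℝ≥0∞, C ≠ ∞ ∧ ∀ f : V → ℝ,
      ENNReal.ofReal ((f x - f y) ^ 2) ≤ C * G.dirichletEnergy f := by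
  obtain ⟨p⟩ := hconn.preconnected x y
  obtain ⟨C, hC, h⟩ := exists_lazyEnergy_le hG p.length
  refine ⟨C, hC, fun f => le_trans ?_ (h f)⟩
  calc ENNReal.ofReal ((f x - f y) ^ 2)
      = 1 * ENNReal.ofReal ((f x - f y) ^ 2) := (one_mul _).symm
    _ ≤ G.lazyWalks p.length x y * ENNReal.ofReal ((f x - f y) ^ 2) := by
        gcongr
        exact one_le_lazyWalks_of_walk _ p le_rfl
    _ ≤ ∑' y, G.lazyWalks p.length x y * ENNReal.ofReal ((f x - f y) ^ 2) :=
        ENNReal.le_tsum (f := fun y =>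
          G.lazyWalks p.length x y * ENNReal.ofReal ((f x - f y) ^ 2)) y
    _ ≤ _ := ENNReal.le_tsum (f := fun x =>
          ∑' y, G.lazyWalks p.length x y * ENNReal.ofReal ((f x - f y) ^ 2)) x

lemma le_kFuzz (G : SimpleGraph V) (k : ℕ) : G ≤ G.kFuzz k :=
  fun _ _ h => ⟨h.ne, Or.inl h⟩

lemma exists_walk_of_kFuzz_adj {k : ℕ} {x y : V} (h : (G.kFuzz k).Adj x y) :
    ∃ p : G.Walk x y, p.length ≤ k + 1 := by
  obtain ⟨-, h | ⟨p, hp⟩⟩ := h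
  · exact ⟨h.toWalk, by simp⟩
  · exact ⟨p, by lia⟩

lemma exists_dirichletEnergy_kFuzz_le (hG : G.BoundedDegree) (k : ℕ) :
    ∃ C : ℝ≥0∞, C ≠ ∞ ∧ ∀ f, (G.kFuzz k).dirichletEnergy f ≤ C * G.dirichletEnergy f := by
  classical
  obtain ⟨C, hC, h⟩ := exists_lazyEnergy_le hG (k + 1)
  refine ⟨C, hC, fun f => le_trans ?_ (h f)⟩
  refine ENNReal.tsum_le_tsum fun x => ENNReal.tsum_le_tsum fun y => ?_
  split_ifs with hxy
  · obtain ⟨p, hp⟩ := exists_walk_of_kFuzz_adj hxy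
    simpa using mul_le_mul_left (one_le_lazyWalks_of_walk _ p hp)
      (ENNReal.ofReal ((f x - f y) ^ 2))
  · exact zero_le

lemma BoundedDegree.finite_neighborSet (hG : G.BoundedDegree) (x : V) :
    (G.neighborSet x).Finite := by
  obtain ⟨E, hE⟩ := hG
  exact Set.finite_of_encard_le_coe (hE x)

lemma BoundedDegree.finite_neighborSet_kFuzz (hG : G.BoundedDegree) (k : ℕ) (x : V) :
    ((G.kFuzz k).neighborSet x).Finite := by
  have key : ∀ n, ∀ y, {x | ∃ p : G.Walk x y, p.length ≤ n}.Finite := by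
    intro n y
    obtain ⟨E, hE⟩ := hG
    have h1 : ∑' x, G.lazyWalks n x y ≠ ∞ :=
      ne_top_of_le_ne_top (by finiteness) (tsum_lazyWalks_le hE n y)
    refine (ENNReal.finite_const_le_of_tsum_ne_top h1 one_ne_zero).subset ?_
    rintro x ⟨p, hp⟩
    exact one_le_lazyWalks_of_walk n p hp
  refine (key (k + 1) x).subset fun y hy => ?_
  exact exists_walk_of_kFuzz_adj (SimpleGraph.Adj.symm hy)

lemma PosCapacity.of_dirichletEnergy_le {o : V} {C : ℝ≥0∞} (hC : C ≠ ∞)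
    (h : ∀ f, G.dirichletEnergy f ≤ C * H.dirichletEnergy f) (hG : G.PosCapacity o) :
    H.PosCapacity o := by
  obtain ⟨K, hK, hf⟩ := hG
  refine ⟨K * C, by finiteness, fun f hfin => (hf f hfin).trans ?_⟩
  rw [mul_assoc]
  gcongr
  exact h f

lemma PosCapacity.congr_vertex (hconn : G.Connected) (hG : G.BoundedDegree) {o o' : V}
    (h : G.PosCapacity o) : G.PosCapacity o' := by
  obtain ⟨K, hK, hf⟩ := h
  obtain ⟨C, hC, hCf⟩ := exists_ofReal_sub_sq_le hconn hG o' o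
  refine ⟨2 * C + 2 * K, by finiteness, fun f hfin => ?_⟩
  calc ENNReal.ofReal (f o' ^ 2)
      ≤ 2 * ENNReal.ofReal ((f o' - f o) ^ 2) + 2 * ENNReal.ofReal (f o ^ 2) := by
        simpa using ofReal_sub_sq_le (f o') (f o) 0
    _ ≤ 2 * (C * G.dirichletEnergy f) + 2 * (K * G.dirichletEnergy f) := by
        gcongr
        · exact hCf f
        · exact hf f hfin
    _ = _ := by ring

/-- Positivity of the capacity depends neither on the vertex nor on passing to a fuzz. -/
lemma posCapacity_kFuzz_iff (hconn : G.Connected) (hG : G.BoundedDegree) (k : ℕ) (o o' : V) :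
    (G.kFuzz k).PosCapacity o' ↔ G.PosCapacity o := by
  obtain ⟨C, hC, h⟩ := exists_dirichletEnergy_kFuzz_le hG k
  constructor
  · intro hk
    exact (hk.of_dirichletEnergy_le hC h).congr_vertex hconn hG
  · intro ho
    refine (ho.congr_vertex hconn hG).of_dirichletEnergy_le (C := 1) (by simp) fun f => ?_
    rw [one_mul]
    exact dirichletEnergy_mono (le_kFuzz G k) f

end Comparison

/-! ### Hitting probabilities -/

section Hitting

variable {V : Type*} (G : SimpleGraph V) [G.LocallyFinite]

/-- The average of `g` over the neighbours of `x`: the transition operator of simple random walk.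
Its value at an isolated vertex is `0`. -/
noncomputable def avg (g : V → ℝ) (x : V) : ℝ := (∑ y ∈ G.neighborFinset x, g y) / G.degree x

open Classical in
/-- The probability that simple random walk started at a vertex is at `o` at some time at most
`n`, defined by recursion on the first step. -/
noncomputable def hitProb (o : V) : ℕ → V → ℝ
  | 0 => fun x => if x = o then 1 else 0
  | n + 1 => fun x => if x = o then 1 else G.avg (hitProb o n) x

variable {G}

lemma avg_mono {g g' : V → ℝ} (h : ∀ x, g x ≤ g' x) (x : V) : G.avg g x ≤ G.avg g' x := by
  unfold avg
  gcongr
  exact h _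

lemma avg_nonneg {g : V → ℝ} (h : ∀ x, 0 ≤ g x) (x : V) : 0 ≤ G.avg g x :=
  div_nonneg (Finset.sum_nonneg fun y _ => h y) (Nat.cast_nonneg _)

lemma avg_le_one {g : V → ℝ} (h : ∀ x, g x ≤ 1) (x : V) : G.avg g x ≤ 1 := by
  refine div_le_one_of_le₀ ?_ (Nat.cast_nonneg _)
  calc ∑ y ∈ G.neighborFinset x, g y ≤ ∑ y ∈ G.neighborFinset x, (1 : ℝ) :=
        Finset.sum_le_sum fun y _ => h y
    _ = G.degree x := by simp

@[simp]
lemma hitProb_self (o : V) (n : ℕ) : G.hitProb o n o = 1 := by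
  cases n <;> simp [hitProb]

lemma hitProb_succ_of_ne {o x : V} (h : x ≠ o) (n : ℕ) :
    G.hitProb o (n + 1) x = G.avg (G.hitProb o n) x := by
  simp [hitProb, h]

lemma hitProb_nonneg (o : V) (n : ℕ) (x : V) : 0 ≤ G.hitProb o n x := by
  induction n generalizing x with
  | zero => simp only [hitProb]; split_ifs <;> norm_num
  | succ n ih =>
    by_cases h : x = o
    · simp [h]
    · rw [hitProb_succ_of_ne h]
      exact avg_nonneg ih x

lemma hitProb_le_one (o : V) (n : ℕ) (x : V) : G.hitProb o n x ≤ 1 := by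
  induction n generalizing x with
  | zero => simp only [hitProb]; split_ifs <;> norm_num
  | succ n ih =>
    by_cases h : x = o
    · simp [h]
    · rw [hitProb_succ_of_ne h]
      exact avg_le_one ih x

lemma hitProb_le_succ (o : V) (n : ℕ) (x : V) : G.hitProb o n x ≤ G.hitProb o (n + 1) x := by
  induction n generalizing x with
  | zero =>
    by_cases h : x = o
    · simp [h]
    · simpa [hitProb, h] using hitProb_nonneg (G := G) o 1 x
  | succ n ih =>
    by_cases h : x = o
    · simp [h]
    · rw [hitProb_succ_of_ne h, hitProb_succ_of_ne h]
      exact avg_mono ih x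

lemma finite_support_hitProb (o : V) (n : ℕ) : (G.hitProb o n).support.Finite := by
  classical
  induction n with
  | zero =>
    refine (Set.finite_singleton o).subset fun x hx => ?_
    by_contra h
    simp_all [hitProb]
  | succ n ih =>
    refine ((Set.finite_singleton o).union
      (ih.biUnion fun y _ => (G.neighborFinset y).finite_toSet)).subset fun x hx => ?_
    by_cases h : x = o
    · exact Or.inl h
    right
    rw [Function.mem_support, hitProb_succ_of_ne h, avg] at hx
    obtain ⟨y, hy, hy0⟩ := Finset.exists_ne_zero_of_sum_ne_zero (left_ne_zero_of_mul hx)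
    simp only [Set.mem_iUnion]
    refine ⟨y, hy0, ?_⟩
    simpa using ((G.mem_neighborFinset _ _).1 hy).symm

/-- The probability of hitting `o` by time `n` from `x` converges. -/
lemma tendsto_hitProb_sub_succ (o x : V) :
    Tendsto (fun n => G.hitProb o n x - G.hitProb o (n + 1) x) atTop (𝓝 0) := by
  have hm : Monotone fun n => G.hitProb o n x := monotone_nat_of_le_succ fun n =>
    hitProb_le_succ o n x
  have h := tendsto_atTop_ciSup hm ⟨1, by rintro _ ⟨n, rfl⟩; exact hitProb_le_one o n x⟩
  simpa using h.sub (h.comp (tendsto_add_atTop_nat 1))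

end Hitting

/-! ### Finite-range Green formula -/

section Green

variable {V : Type*} {G : SimpleGraph V}

open Classical in
lemma sum_le_dirichletEnergy (f : V → ℝ) (T : Finset V) :
    ENNReal.ofReal (∑ x ∈ T, ∑ y ∈ T, if G.Adj x y then (f x - f y) ^ 2 else 0)
      ≤ G.dirichletEnergy f := by
  have h0 : ∀ x y, 0 ≤ (if G.Adj x y then (f x - f y) ^ 2 else 0) := by
    intro x y; split_ifs <;> positivity
  rw [ENNReal.ofReal_sum_of_nonneg fun x _ => Finset.sum_nonneg fun y _ => h0 x y]
  refine le_trans (Finset.sum_le_sum fun x _ => ?_) (ENNReal.sum_le_tsum T)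
  rw [ENNReal.ofReal_sum_of_nonneg fun y _ => h0 x y]
  refine le_trans (Finset.sum_le_sum fun y _ => ?_) (ENNReal.sum_le_tsum T)
  split_ifs <;> simp

open Classical in
lemma dirichletEnergy_eq_sum {f : V → ℝ} {T : Finset V} (hT : f.support ⊆ T)
    (hN : ∀ x ∈ f.support, ∀ y, G.Adj x y → y ∈ T) :
    G.dirichletEnergy f
      = ENNReal.ofReal (∑ x ∈ T, ∑ y ∈ T, if G.Adj x y then (f x - f y) ^ 2 else 0) := by
  have h0 : ∀ x y, 0 ≤ (if G.Adj x y then (f x - f y) ^ 2 else 0) := by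
    intro x y; split_ifs <;> positivity
  have hz : ∀ x y, x ∉ T ∨ y ∉ T →
      (if G.Adj x y then ENNReal.ofReal ((f x - f y) ^ 2) else 0) = 0 := by
    intro x y h
    split_ifs with hxy
    · have hx : f x = 0 := by
        by_contra hx
        exact h.elim (fun h => h (hT hx)) (fun h => h (hN x hx y hxy))
      have hy : f y = 0 := by
        by_contra hy
        exact h.elim (fun h => h (hN y hy x hxy.symm)) (fun h => h (hT hy))
      simp [hx, hy]
    · rfl
  rw [ENNReal.ofReal_sum_of_nonneg fun x _ => Finset.sum_nonneg fun y _ => h0 x y,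
    dirichletEnergy, tsum_eq_sum (s := T)]
  · refine Finset.sum_congr rfl fun x _ => ?_
    rw [ENNReal.ofReal_sum_of_nonneg fun y _ => h0 x y, tsum_eq_sum (s := T)]
    · refine Finset.sum_congr rfl fun y _ => ?_
      split_ifs <;> simp
    · exact fun y hy => hz x y (Or.inr hy)
  · exact fun x hx => ENNReal.tsum_eq_zero.2 fun y => hz x y (Or.inl hx)

open Classical in
/-- The Cauchy-Schwarz inequality for the energy form on a finite set. -/
lemma sq_energyForm_le (f g : V → ℝ) (T : Finset V) :
    (∑ x ∈ T, ∑ y ∈ T, if G.Adj x y then (f x - f y) * (g x - g y) else 0) ^ 2 ≤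
      (∑ x ∈ T, ∑ y ∈ T, if G.Adj x y then (f x - f y) ^ 2 else 0) *
        ∑ x ∈ T, ∑ y ∈ T, if G.Adj x y then (g x - g y) ^ 2 else 0 := by
  simp_rw [← Finset.sum_product']
  simp_rw [← Finset.sum_filter]
  exact Finset.sum_mul_sq_le_sq_mul_sq _ _ _

variable [G.LocallyFinite]

open Classical in
/-- Summation by parts: if the finite set `T` contains the neighbours of the support of `f`, the
energy form of `f` and `g` over `T` is twice the degree-weighted sum of `f` against the Laplacian
`g - G.avg g`. -/
lemma green_formula {f g : V → ℝ} {T : Finset V}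
    (hN : ∀ x ∈ f.support, ∀ y, G.Adj x y → y ∈ T) (hpos : ∀ x, 0 < G.degree x) :
    ∑ x ∈ T, ∑ y ∈ T, (if G.Adj x y then (f x - f y) * (g x - g y) else 0)
      = 2 * ∑ x ∈ T, G.degree x * (f x * (g x - G.avg g x)) := by
  have h1 : ∑ x ∈ T, ∑ y ∈ T, (if G.Adj x y then f x * (g x - g y) else 0)
      = ∑ x ∈ T, G.degree x * (f x * (g x - G.avg g x)) := by
    refine Finset.sum_congr rfl fun x _ => ?_
    by_cases hx : f x = 0
    · simp [hx]
    have hsub : T.filter (fun y => G.Adj x y) = G.neighborFinset x := by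
      ext y
      simp only [Finset.mem_filter, mem_neighborFinset]
      exact ⟨fun h => h.2, fun h => ⟨hN x hx y h, h⟩⟩
    have hd : (G.degree x : ℝ) ≠ 0 := by exact_mod_cast (hpos x).ne'
    rw [← Finset.sum_filter, hsub, ← Finset.mul_sum, Finset.sum_sub_distrib, avg]
    simp only [Finset.sum_const, card_neighborFinset_eq_degree, nsmul_eq_mul]
    field_simp
  have h2 : ∑ x ∈ T, ∑ y ∈ T, (if G.Adj x y then f y * (g y - g x) else 0)
      = ∑ x ∈ T, ∑ y ∈ T, (if G.Adj x y then f x * (g x - g y) else 0) := by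
    rw [Finset.sum_comm]
    simp_rw [G.adj_comm]
  rw [two_mul, ← h1]
  nth_rw 2 [← h2]
  simp_rw [← Finset.sum_add_distrib]
  refine Finset.sum_congr rfl fun x _ => Finset.sum_congr rfl fun y _ => ?_
  split_ifs <;> ring

/-- A finitely supported function admits a finite set that contains its support and all
neighbours of its support. -/
lemma exists_finset_closedNeighborhood {f : V → ℝ} (hf : f.support.Finite) :
    ∃ T : Finset V, f.support ⊆ T ∧ ∀ x ∈ f.support, ∀ y, G.Adj x y → y ∈ T := by
  classical
  refine ⟨hf.toFinset ∪ hf.toFinset.biUnion fun x => G.neighborFinset x, fun x hx => ?_,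
    fun x hx y hxy => ?_⟩
  · have : f x ≠ 0 := hx
    simp [this]
  · have : f x ≠ 0 := hx
    simp only [Finset.mem_union, Finset.mem_biUnion, Set.Finite.mem_toFinset, mem_neighborFinset]
    exact Or.inr ⟨x, hx, hxy⟩

open Classical in
/-- The truncated hitting probability is subharmonic off `o`, so its energy is at most
twice `G.degree o` times its Laplacian at `o`. -/
lemma sum_hitProb_le {o : V} (hpos : ∀ x, 0 < G.degree x) (n : ℕ) {T : Finset V}
    (hT : (G.hitProb o n).support ⊆ T)
    (hN : ∀ x ∈ (G.hitProb o n).support, ∀ y, G.Adj x y → y ∈ T) :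
    ∑ x ∈ T, ∑ y ∈ T, (if G.Adj x y then (G.hitProb o n x - G.hitProb o n y) ^ 2 else 0)
      ≤ 2 * (G.degree o * (1 - G.avg (G.hitProb o n) o)) := by
  have h := green_formula (g := G.hitProb o n) hN hpos
  simp_rw [← pow_two] at h
  rw [h]
  have ho : o ∈ T := hT (by simp)
  rw [← Finset.add_sum_erase _ _ ho, hitProb_self, one_mul]
  gcongr
  refine add_le_of_nonpos_right (Finset.sum_nonpos fun x hx => ?_)
  have hx' : x ≠ o := Finset.ne_of_mem_erase hx
  rw [← hitProb_succ_of_ne hx']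
  exact mul_nonpos_of_nonneg_of_nonpos (Nat.cast_nonneg _)
    (mul_nonpos_of_nonneg_of_nonpos (hitProb_nonneg o n x)
      (by linarith [hitProb_le_succ (G := G) o n x]))

lemma dirichletEnergy_hitProb_le {o : V} (hpos : ∀ x, 0 < G.degree x) (n : ℕ) :
    G.dirichletEnergy (G.hitProb o n)
      ≤ ENNReal.ofReal (2 * (G.degree o * (1 - G.avg (G.hitProb o n) o))) := by
  obtain ⟨T, hT, hN⟩ :=
    exists_finset_closedNeighborhood (G := G) (finite_support_hitProb (G := G) o n)
  rw [dirichletEnergy_eq_sum hT hN]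
  exact ENNReal.ofReal_le_ofReal (sum_hitProb_le hpos n hT hN)

/-- If the probability of returning to `o` by time `n + 1` tends to `1`, then the truncated hitting
probabilities show that `o` has zero capacity. -/
lemma not_posCapacity_of_tendsto_avg {o : V} (hpos : ∀ x, 0 < G.degree x)
    (h : Tendsto (fun n => 1 - G.avg (G.hitProb o n) o) atTop (𝓝 0)) : ¬ G.PosCapacity o := by
  rintro ⟨C, hC, hf⟩
  have h1 : Tendsto (fun n => C * ENNReal.ofReal (2 * (G.degree o *
      (1 - G.avg (G.hitProb o n) o)))) atTop (𝓝 0) := by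
    have := ENNReal.Tendsto.const_mul (a := C)
      (ENNReal.tendsto_ofReal ((h.const_mul (G.degree o : ℝ)).const_mul 2)) (Or.inr hC)
    simpa using this
  have h2 : (1 : ℝ≥0∞) ≤ 0 := by
    refine ge_of_tendsto' h1 fun n => ?_
    calc (1 : ℝ≥0∞) = ENNReal.ofReal (G.hitProb o n o ^ 2) := by simp
      _ ≤ C * G.dirichletEnergy (G.hitProb o n) := hf _ (finite_support_hitProb o n)
      _ ≤ _ := by gcongr; exact dirichletEnergy_hitProb_le hpos n
  simp at h2

/-- If the probability of never returning to `o` is positive, then testing a function against the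
truncated hitting probabilities bounds its value at `o` by its energy. -/
lemma posCapacity_of_tendsto_avg {o : V} {p : ℝ} (hp : 0 < p) (hpos : ∀ x, 0 < G.degree x)
    (h : Tendsto (fun n => 1 - G.avg (G.hitProb o n) o) atTop (𝓝 p)) : G.PosCapacity o := by
  classical
  have hd : 0 < (G.degree o : ℝ) := by exact_mod_cast hpos o
  refine ⟨ENNReal.ofReal (1 / (2 * G.degree o * p)), ENNReal.ofReal_ne_top, fun f hf => ?_⟩
  obtain ⟨T₀, -, hN₀⟩ := exists_finset_closedNeighborhood (G := G) hf
  set T := insert o T₀ with hTdef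
  have hN : ∀ x ∈ f.support, ∀ y, G.Adj x y → y ∈ T := fun x hx y hxy =>
    Finset.mem_insert_of_mem (hN₀ x hx y hxy)
  set D := ∑ x ∈ T, ∑ y ∈ T, if G.Adj x y then (f x - f y) ^ 2 else 0 with hD
  have hD0 : 0 ≤ D := Finset.sum_nonneg fun x _ => Finset.sum_nonneg fun y _ => by
    split_ifs <;> positivity
  -- The Laplacian of the truncated hitting probabilities tends to a point mass at `o`.
  have hlap : Tendsto (fun n => 2 * ∑ x ∈ T, G.degree x *
      (f x * (G.hitProb o n x - G.avg (G.hitProb o n) x))) atTop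
      (𝓝 (2 * (G.degree o * (f o * p)))) := by
    refine Tendsto.const_mul 2 ?_
    have : (G.degree o * (f o * p) : ℝ) =
        ∑ x ∈ T, if x = o then (G.degree o * (f o * p) : ℝ) else 0 := by
      simp [hTdef]
    rw [this]
    refine tendsto_finsetSum _ fun x _ => ?_
    by_cases hx : x = o
    · subst hx
      simpa using (h.const_mul (f x)).const_mul (G.degree x : ℝ)
    · simp only [hx, if_false, ← hitProb_succ_of_ne hx]
      simpa using ((tendsto_hitProb_sub_succ (G := G) o x).const_mul (f x)).const_mul
        (G.degree x : ℝ)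
  have hle : (2 * (G.degree o * (f o * p))) ^ 2 ≤ D * (2 * (G.degree o * p)) := by
    refine le_of_tendsto_of_tendsto' (hlap.pow 2)
      (((h.const_mul (G.degree o : ℝ)).const_mul 2).const_mul D) fun n => ?_
    rw [← green_formula hN hpos]
    refine (sq_energyForm_le f _ T).trans ?_
    gcongr
    -- Enlarge `T` so that it also carries the support of the truncated hitting probability.
    obtain ⟨S, hS, hNS⟩ :=
      exists_finset_closedNeighborhood (G := G) (finite_support_hitProb (G := G) o n)
    have h0 : ∀ x y, 0 ≤
        (if G.Adj x y then (G.hitProb o n x - G.hitProb o n y) ^ 2 else 0) := by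
      intro x y; split_ifs <;> positivity
    refine le_trans ?_ (sum_hitProb_le hpos n (T := T ∪ S)
      (hS.trans (by simp)) fun x hx y hxy => Finset.mem_union_right _ (hNS x hx y hxy))
    calc _ ≤ ∑ x ∈ T, ∑ y ∈ T ∪ S, _ := Finset.sum_le_sum fun x _ =>
          Finset.sum_le_sum_of_subset_of_nonneg Finset.subset_union_left fun y _ _ => h0 x y
      _ ≤ _ := Finset.sum_le_sum_of_subset_of_nonneg Finset.subset_union_left fun x _ _ =>
          Finset.sum_nonneg fun y _ => h0 x y
  have hfo : f o ^ 2 ≤ 1 / (2 * G.degree o * p) * D := by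
    rw [one_div_mul_eq_div, le_div_iff₀ (by positivity)]
    have hc : 0 < 2 * (G.degree o : ℝ) * p := by positivity
    refine le_of_mul_le_mul_right ?_ hc
    nlinarith
  calc ENNReal.ofReal (f o ^ 2) ≤ ENNReal.ofReal (1 / (2 * G.degree o * p) * D) :=
        ENNReal.ofReal_le_ofReal hfo
    _ = ENNReal.ofReal (1 / (2 * G.degree o * p)) * ENNReal.ofReal D :=
        ENNReal.ofReal_mul (by positivity)
    _ ≤ _ := by gcongr; exact sum_le_dirichletEnergy f T

end Green

/-! ### The escape probability as a limit of hitting probabilities -/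

/-- The event of avoiding `o` at the times `1, …, n`. -/
def avoidUntil {V : Type*} (o : V) (n : ℕ) : Set (ℕ → V) := {ω | ∀ m, 1 ≤ m → m ≤ n → ω m ≠ o}

lemma indicator_avoidUntil_succ {V : Type*} (o : V) (n : ℕ) (ω : ℕ → V) :
    (avoidUntil o (n + 1)).indicator (1 : (ℕ → V) → ℝ≥0∞) ω =
      (avoidUntil o n).indicator 1 ω * ({o}ᶜ : Set V).indicator 1 (ω (n + 1)) := by
  classical
  have h : ω ∈ avoidUntil o (n + 1) ↔ ω ∈ avoidUntil o n ∧ ω (n + 1) ∈ ({o}ᶜ : Set V) := by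
    constructor
    · exact fun h => ⟨fun m h1 h2 => h m h1 (by lia), h _ (by lia) le_rfl⟩
    · rintro ⟨h, h'⟩ m h1 h2
      obtain rfl | h3 := eq_or_lt_of_le h2
      · exact h'
      · exact h m h1 (by lia)
  by_cases h1 : ω ∈ avoidUntil o n <;> by_cases h2 : ω (n + 1) ∈ ({o}ᶜ : Set V) <;>
    simp only [Set.indicator_apply, h, h1, h2, Pi.one_apply] <;> simp

lemma measurableSet_avoidUntil {V : Type*} [MeasurableSpace V] [DiscreteMeasurableSpace V]
    (o : V) (n : ℕ) : MeasurableSet (avoidUntil o n) := by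
  have : avoidUntil o n =
      ⋂ m, ⋂ (_ : 1 ≤ m), ⋂ (_ : m ≤ n), {ω : ℕ → V | ω m ∈ ({o}ᶜ : Set V)} := by
    ext ω
    simp [avoidUntil]
  rw [this]
  exact .iInter fun m => .iInter fun _ => .iInter fun _ => measurable_pi_apply m .of_discrete

section Markov

variable {V : Type*} [MeasurableSpace V] [DiscreteMeasurableSpace V] (G : SimpleGraph V)

/-- The simple Markov property at time `j`. -/
lemma lintegral_srwLaw_succ (o : V) (j : ℕ) {F : (Π _ : Finset.Iic j, V) → ℝ≥0∞}
    (hF : Measurable F) (g : V → ℝ≥0∞) :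
    ∫⁻ ω, F (Preorder.frestrictLe j ω) * g (ω (j + 1)) ∂G.srwLaw o =
      ∫⁻ ω, F (Preorder.frestrictLe j ω) * ∫⁻ y, g y ∂(G.srwStep (ω j)).toMeasure
        ∂G.srwLaw o := by
  have hg : Measurable g := .of_discrete
  have hm : Measurable fun x : V => ∫⁻ y, g y ∂(G.srwStep x).toMeasure := .of_discrete
  have hj : Measurable fun y : (Π _ : Finset.Iic j, V) =>
      F y * ∫⁻ z, g z ∂(G.srwStep (y ⟨j, Finset.mem_Iic.2 le_rfl⟩)).toMeasure :=
    hF.mul (hm.comp (measurable_pi_apply _))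
  have hF' : Measurable fun ω : ℕ → V => F (Preorder.frestrictLe j ω) :=
    hF.comp (by fun_prop)
  have hf : Measurable fun ω : ℕ → V => F (Preorder.frestrictLe j ω) * g (ω (j + 1)) :=
    hF'.mul (hg.comp (measurable_pi_apply _))
  have hgj : Measurable fun ω : ℕ → V => g (ω (j + 1)) :=
    hg.comp (measurable_pi_apply (j + 1))
  have inner : ∀ y : (Π _ : Finset.Iic j, V),
      ∫⁻ ω, F (Preorder.frestrictLe j ω) * g (ω (j + 1))
        ∂(Kernel.traj (X := fun _ => V) G.srwKernel j y) =
      F y * ∫⁻ z, g z ∂(G.srwStep (y ⟨j, Finset.mem_Iic.2 le_rfl⟩)).toMeasure := by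
    intro y
    rw [Kernel.lintegral_traj (X := fun _ => V) y hf]
    have h1 : ∀ ω : ℕ → V,
        Preorder.frestrictLe (π := fun _ => V) j
          (Function.updateFinset ω (Finset.Iic j) y) = y := by
      intro ω
      ext i
      simp [Function.updateFinset]
    have h2 : ∀ ω : ℕ → V, Function.updateFinset ω (Finset.Iic j) y (j + 1) = ω (j + 1) := by
      intro ω
      simp [Function.updateFinset]
    simp_rw [h1, h2]
    rw [lintegral_const_mul _ hgj,
      ← lintegral_map (f := g) (g := fun ω : ℕ → V => ω (j + 1)) hg (measurable_pi_apply _),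
      ← Kernel.map_apply _ (measurable_pi_apply _), Kernel.map_traj_succ_self]
    rfl
  have hlaw : G.srwLaw o = Measure.bind
      (Kernel.partialTraj (X := fun _ => V) G.srwKernel 0 j (fun _ => o))
      (Kernel.traj (X := fun _ => V) G.srwKernel j) := by
    rw [srwLaw, ← Kernel.traj_comp_partialTraj (Nat.zero_le j), Kernel.comp_apply]
  have hmap : (G.srwLaw o).map (Preorder.frestrictLe j) =
      Kernel.partialTraj (X := fun _ => V) G.srwKernel 0 j (fun _ => o) :=
    Kernel.traj_map_frestrictLe_apply ..
  conv_lhs => rw [hlaw]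
  rw [Measure.lintegral_bind (Kernel.aemeasurable _) hf.aemeasurable]
  simp_rw [inner]
  rw [← hmap, lintegral_map hj (by fun_prop)]
  rfl

lemma lintegral_srwLaw_zero (o : V) (g : V → ℝ≥0∞) : ∫⁻ ω, g (ω 0) ∂G.srwLaw o = g o := by
  have hmap : (G.srwLaw o).map (Preorder.frestrictLe 0) =
      Kernel.partialTraj (X := fun _ => V) G.srwKernel 0 0 (fun _ => o) :=
    Kernel.traj_map_frestrictLe_apply ..
  have hg : Measurable fun y : (Π _ : Finset.Iic 0, V) => g (y ⟨0, by simp⟩) :=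
    (Measurable.of_discrete (f := g)).comp (measurable_pi_apply _)
  calc ∫⁻ ω, g (ω 0) ∂G.srwLaw o
      = ∫⁻ y, g (y ⟨0, by simp⟩) ∂((G.srwLaw o).map (Preorder.frestrictLe 0)) := by
        rw [lintegral_map hg (by fun_prop)]
        rfl
    _ = g o := by
        rw [hmap, Kernel.partialTraj_self, Kernel.id_apply, lintegral_dirac' _ hg]

instance isProbabilityMeasure_srwLaw (o : V) : IsProbabilityMeasure (G.srwLaw o) := by
  unfold srwLaw
  infer_instance

variable {G} [G.LocallyFinite]

lemma lintegral_srwStep {x : V} (hx : 0 < G.degree x) (g : V → ℝ≥0∞) :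
    ∫⁻ y, g y ∂(G.srwStep x).toMeasure =
      (G.degree x : ℝ≥0∞)⁻¹ * ∑ y ∈ G.neighborFinset x, g y := by
  classical
  have hne : (G.neighborFinset x).Nonempty := Finset.card_pos.1 hx
  have hstep : G.srwStep x = PMF.uniformOfFinset (G.neighborFinset x) hne := by
    have h : (G.neighborSet x).Finite ∧ (G.neighborSet x).Nonempty :=
      ⟨Set.toFinite _, by obtain ⟨y, hy⟩ := hne; exact ⟨y, by simpa using hy⟩⟩
    rw [srwStep, dif_pos h]
    congr 1
    ext y
    simp
  have hmeas : (G.srwStep x).toMeasure =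
      (G.degree x : ℝ≥0∞)⁻¹ • ∑ y ∈ G.neighborFinset x, Measure.dirac y := by
    ext s hs
    rw [hstep, PMF.toMeasure_uniformOfFinset_apply _ s hs]
    simp only [Measure.smul_apply, Measure.finsetSum_apply, Measure.dirac_apply' _ hs, smul_eq_mul,
      card_neighborFinset_eq_degree, Set.indicator_apply, Pi.one_apply, Finset.sum_boole]
    rw [div_eq_mul_inv, mul_comm]
  rw [hmeas, lintegral_smul_measure, lintegral_finsetSum_measure, smul_eq_mul]
  simp_rw [lintegral_dirac' _ (Measurable.of_discrete (f := g))]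

lemma lintegral_srwStep_one_sub {x : V} (hx : 0 < G.degree x) {h : V → ℝ} (h1 : ∀ y, h y ≤ 1) :
    ∫⁻ y, ENNReal.ofReal (1 - h y) ∂(G.srwStep x).toMeasure =
      ENNReal.ofReal (1 - G.avg h x) := by
  have hd : 0 < (G.degree x : ℝ) := by exact_mod_cast hx
  rw [lintegral_srwStep hx, ← ENNReal.ofReal_sum_of_nonneg fun y _ => by linarith [h1 y],
    ← ENNReal.ofReal_natCast, ← ENNReal.ofReal_inv_of_pos hd,
    ← ENNReal.ofReal_mul (by positivity), Finset.sum_sub_distrib, avg]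
  congr 1
  simp only [Finset.sum_const, card_neighborFinset_eq_degree, nsmul_eq_mul]
  field_simp

/-- The simple Markov property on the event of avoiding `o`. -/
lemma lintegral_avoidUntil_mul (hpos : ∀ x, 0 < G.degree x) (o o' : V) (j : ℕ) {h : V → ℝ}
    (h1 : ∀ y, h y ≤ 1) :
    ∫⁻ ω, (avoidUntil o j).indicator 1 ω * ENNReal.ofReal (1 - h (ω (j + 1))) ∂G.srwLaw o' =
      ∫⁻ ω, (avoidUntil o j).indicator 1 ω * ENNReal.ofReal (1 - G.avg h (ω j))
        ∂G.srwLaw o' := by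
  set A : Set (Π _ : Finset.Iic j, V) := ⋂ i, {y | 1 ≤ i.1 → y i ≠ o} with hA
  have hAm : MeasurableSet A := by
    refine .iInter fun i => ?_
    by_cases hi : 1 ≤ i.1
    · have hm : Measurable fun y : (Π _ : Finset.Iic j, V) => y i := measurable_pi_apply i
      simp only [hi, true_imp_iff]
      exact hm (.of_discrete : MeasurableSet ({o}ᶜ : Set V))
    · simp [hi]
  have hind : ∀ ω : ℕ → V, (avoidUntil o j).indicator (1 : (ℕ → V) → ℝ≥0∞) ω =
      A.indicator 1 (Preorder.frestrictLe j ω) := by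
    intro ω
    have : ω ∈ avoidUntil o j ↔ Preorder.frestrictLe (π := fun _ => V) j ω ∈ A := by
      simp only [avoidUntil, hA, Set.mem_ofPred_eq, Set.mem_iInter, Subtype.forall, Finset.mem_Iic,
        Preorder.frestrictLe_apply]
      exact forall_congr' fun m => forall_comm
    classical
    simp only [Set.indicator_apply, this, Pi.one_apply]
  simp_rw [hind]
  rw [G.lintegral_srwLaw_succ o' j (F := A.indicator 1) (measurable_one.indicator hAm)
    (fun x => ENNReal.ofReal (1 - h x))]
  simp_rw [lintegral_srwStep_one_sub (hpos _) h1]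

lemma lintegral_avoidUntil_hitProb (hpos : ∀ x, 0 < G.degree x) (o o' : V) (j m : ℕ) :
    ∫⁻ ω, (avoidUntil o j).indicator 1 ω * ENNReal.ofReal (1 - G.hitProb o m (ω (j + 1)))
      ∂G.srwLaw o' = G.srwLaw o' (avoidUntil o (j + 1 + m)) := by
  classical
  induction m generalizing j with
  | zero =>
    have h : ∀ x, ENNReal.ofReal (1 - G.hitProb o 0 x) = ({o}ᶜ : Set V).indicator 1 x := by
      intro x
      by_cases hx : x = o <;> simp [hitProb, hx]
    simp_rw [h, ← indicator_avoidUntil_succ]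
    exact lintegral_indicator_one (measurableSet_avoidUntil o _)
  | succ m ih =>
    have h : ∀ x, ENNReal.ofReal (1 - G.hitProb o (m + 1) x) =
        ({o}ᶜ : Set V).indicator 1 x * ENNReal.ofReal (1 - G.avg (G.hitProb o m) x) := by
      intro x
      by_cases hx : x = o <;> simp [hitProb, hx]
    simp_rw [h, ← mul_assoc, ← indicator_avoidUntil_succ]
    rw [← lintegral_avoidUntil_mul hpos o o' (j + 1) (hitProb_le_one o m), ih]
    congr 2
    lia

/-- The probability of avoiding `o` at the times `1, …, n + 1` when starting at `o`. -/
lemma srwLaw_avoidUntil (hpos : ∀ x, 0 < G.degree x) (o : V) (n : ℕ) :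
    G.srwLaw o (avoidUntil o (n + 1)) = ENNReal.ofReal (1 - G.avg (G.hitProb o n) o) := by
  have h0 : avoidUntil o 0 = Set.univ := by
    ext ω
    simp only [avoidUntil, Set.mem_ofPred_eq, Set.mem_univ, iff_true]
    intro m h1 h2
    lia
  have h := lintegral_avoidUntil_hitProb hpos o o 0 n
  rw [lintegral_avoidUntil_mul hpos o o 0 (hitProb_le_one o n), h0] at h
  simp only [Set.indicator_univ, Pi.one_apply, one_mul, zero_add] at h
  rw [add_comm, ← h]
  exact G.lintegral_srwLaw_zero o fun x => ENNReal.ofReal (1 - G.avg (G.hitProb o n) x)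

end Markov

section Escape

variable {V : Type*} {G : SimpleGraph V} [G.LocallyFinite]

lemma tendsto_escapeProb (hpos : ∀ x, 0 < G.degree x) (o : V) :
    Tendsto (fun n => ENNReal.ofReal (1 - G.avg (G.hitProb o n) o)) atTop
      (𝓝 (G.escapeProb o)) := by
  let _ : MeasurableSpace V := ⊤
  have hset : {ω : ℕ → V | ∀ n : ℕ, 1 ≤ n → ω n ≠ o} = ⋂ n, avoidUntil o (n + 1) := by
    ext ω
    simp only [avoidUntil, Set.mem_ofPred_eq, Set.mem_iInter]
    exact ⟨fun h _ m h1 _ => h m h1, fun h m h1 => h m m h1 (by lia)⟩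
  have hanti : Antitone fun n => avoidUntil o (n + 1) :=
    fun a b hab ω h m h1 h2 => h m h1 (by lia)
  have := tendsto_measure_iInter_atTop (μ := G.srwLaw o)
    (fun n => (measurableSet_avoidUntil o (n + 1)).nullMeasurableSet) hanti
    ⟨0, measure_ne_top _ _⟩
  rw [← hset] at this
  simp only [Function.comp_def, srwLaw_avoidUntil hpos] at this
  exact this

lemma tendsto_toReal_escapeProb (hpos : ∀ x, 0 < G.degree x) (o : V) :
    Tendsto (fun n => 1 - G.avg (G.hitProb o n) o) atTop (𝓝 (G.escapeProb o).toReal) := by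
  have hfin : G.escapeProb o ≠ ∞ := by
    let _ : MeasurableSpace V := ⊤
    exact measure_ne_top (G.srwLaw o) _
  have h := (ENNReal.tendsto_toReal hfin).comp (tendsto_escapeProb hpos o)
  refine h.congr fun n => ENNReal.toReal_ofReal ?_
  linarith [avg_le_one (G := G) (hitProb_le_one (G := G) o n) o]

/-- Simple random walk is transient exactly when its reference point has positive capacity. -/
theorem srwTransient_iff_posCapacity (hpos : ∀ x, 0 < G.degree x) (o : V) :
    G.SrwTransient o ↔ G.PosCapacity o := by
  have hlim := tendsto_toReal_escapeProb hpos o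
  have hfin : G.escapeProb o ≠ ∞ := by
    let _ : MeasurableSpace V := ⊤
    exact measure_ne_top (G.srwLaw o) _
  constructor
  · intro h
    exact posCapacity_of_tendsto_avg (ENNReal.toReal_pos h.ne' hfin) hpos hlim
  · intro h
    refine pos_iff_ne_zero.2 fun h0 => ?_
    rw [h0, ENNReal.toReal_zero] at hlim
    exact not_posCapacity_of_tendsto_avg hpos hlim h

end Escape

end SimpleGraph

/-! ### Invariance of the type under fuzzing -/

theorem mainTheorem4 {V : Type*} [Infinite V] (G : SimpleGraph V) (hconn : G.Connected)
    (hdeg : G.BoundedDegree) (k : ℕ) (o o' : V) :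
    (G.SrwRecurrent o ∧ (G.kFuzz k).SrwRecurrent o') ∨
      (G.SrwTransient o ∧ (G.kFuzz k).SrwTransient o') := by
  let _ : G.LocallyFinite := fun x => (hdeg.finite_neighborSet x).fintype
  let _ : (G.kFuzz k).LocallyFinite := fun x => (hdeg.finite_neighborSet_kFuzz k x).fintype
  have hex : ∀ x, ∃ y, G.Adj x y := fun x => hconn.preconnected.exists_adj_of_nontrivial x
  have hpos : ∀ x, 0 < G.degree x := fun x => (G.degree_pos_iff_exists_adj x).2 (hex x)
  have hpos' : ∀ x, 0 < (G.kFuzz k).degree x := fun x =>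
    ((G.kFuzz k).degree_pos_iff_exists_adj x).2 ((hex x).imp fun _ h => G.le_kFuzz k h)
  have hiff : G.SrwTransient o ↔ (G.kFuzz k).SrwTransient o' := by
    rw [SimpleGraph.srwTransient_iff_posCapacity hpos,
      SimpleGraph.srwTransient_iff_posCapacity hpos',
      SimpleGraph.posCapacity_kFuzz_iff hconn hdeg k o o']
  by_cases h : G.SrwTransient o
  · exact Or.inr ⟨h, hiff.1 h⟩
  · exact Or.inl ⟨by_contra fun h' => h (pos_iff_ne_zero.2 h'),
      by_contra fun h' => h (hiff.2 (pos_iff_ne_zero.2 h'))⟩
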